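/- \textbf{Setting.} Let $n,m,l,T\ge 0$ be integers and let $f:\mathbb R^n\times\mathbb R^m\times\mathbb R^l\to\mathbb R^n$ be Borel measurable. For every $x\in\mathbb R^n$ let $\mathbb U(x)\subseteq\mathbb R^m$ be a set of admissible controls, such that some measurable $\kappa:\mathbb R^n\to\mathbb R^m$ satisfies $\kappa(x)\in\mathbb U(x)$ for all $x$. For $t=0,\dots,T-1$ let $\mathbb D_t$ be a nonempty set of Borel probability measures on $\mathbb R^l$ (the ambiguity set for the disturbance at stage $t$); the probability measures carry the topology of weak convergence. Let $A\subseteq\mathbb R^n$ be compact, with indicator function $\mathbf 1_A$. Let $Q(\cdot\,|\,x,u,\mu)$ be the law of $f(x,u,w)$ when $w$ has distribution $\mu$. For $t=0,\dots,T-1$ and $v:\mathbb R^n\to\mathbb R$ put $$\mathbf T_t v(x):=\sup_{u\in\mathbb U(x)}\ \inf_{\mu\in\mathbb D_t}\ \mathbf 1_A(x)\int_{\mathbb R^n}v(\xi)\,Q(d\xi\,|\,x,u,\mu),$$ and define the value functions by $v_t:=\mathbf T_t\circ\mathbf T_{t+1}\circ\cdots\circ\mathbf T_{T-1}\mathbf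 1_A$ for $0\le t\le T$ (the empty composition, for $t=T$, is the identity). \textbf{Semi-continuity assumption.} (i) For every $t<T$ and every bounded continuous $g:\mathbb R^n\to\mathbb R$, the function $(x,u,\mu)\mapsto\int_{\mathbb R^n} g(\xi)\,Q(d\xi\,|\,x,u,\mu)$ is continuous on $\{(x,u,\mu): u\in\mathbb U(x),\ \mu\in\mathbb D_t\}$. (ii) $\mathbb U(x)$ is compact for every $x$, and the set-valued map $x\mapsto\mathbb U(x)$ is upper semi-continuous. (iii) $\mathbb D_t$ is $\sigma$-compact for every $t<T$. \textbf{Proposition (Bellman equation).} Under the semi-continuity assumption, $v_T=\mathbf 1_A$, and for all $t\in\{0,\dots,T-1\}$ and $x\in\mathbb R^n$, $$v_t(x)=\max_{u\in\mathbb U(x)}\ \inf_{\mu\in\mathbb D_t}\ \mathbf 1_A(x)\int_{\mathbb R^l}v_{t+1}\big(f(x,u,w)\big)\,d\mu(w),$$ where the integrals on the right are well defined (the integrands are $\mu$-integrable for $u\in\mathbb U(x)$, $\mu\in\mathbb D_t$) and the outer maximum is attained. -/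

import Mathlib

open MeasureTheory Set
open scoped BoundedContinuousFunction

namespace RobustSafety

/-- The state, control and disturbance spaces are Euclidean spaces. -/
abbrev Vec (k : ℕ) : Type := EuclideanSpace ℝ (Fin k)

/-- The transition law `Q(dξ | x, u, μ)`: the law of the next state `f(x, u, w)` when the
disturbance `w` has distribution `μ`. -/
noncomputable def transitionLaw {n m l : ℕ} (f : Vec n → Vec m → Vec l → Vec n)
    (x : Vec n) (u : Vec m) (μ : ProbabilityMeasure (Vec l)) : Measure (Vec n) :=
  (μ : Measure (Vec l)).map (f x u)

/-- The admissible triples `(x, u, μ)` for the admissible controls `U` and the ambiguity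
set `D` of one stage. -/
def admissibleTriples {n m l : ℕ} (U : Vec n → Set (Vec m))
    (D : Set (ProbabilityMeasure (Vec l))) :
    Set (Vec n × Vec m × ProbabilityMeasure (Vec l)) :=
  {p | p.2.1 ∈ U p.1 ∧ p.2.2 ∈ D}

/-- The semi-continuity assumption over the stages `0, …, T - 1`.
`ProbabilityMeasure` carries the topology of weak convergence. -/
structure SemicontinuousModel {n m l : ℕ} (f : Vec n → Vec m → Vec l → Vec n)
    (U : Vec n → Set (Vec m)) (D : ℕ → Set (ProbabilityMeasure (Vec l))) (T : ℕ) : Prop where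
  continuousOn_integral : ∀ t < T, ∀ g : Vec n →ᵇ ℝ,
    ContinuousOn
      (fun p : Vec n × Vec m × ProbabilityMeasure (Vec l) =>
        ∫ ξ, g ξ ∂(transitionLaw f p.1 p.2.1 p.2.2))
      (admissibleTriples U (D t))
  isCompact_controls : ∀ x, IsCompact (U x)
  upperHemicontinuous_controls : UpperHemicontinuous U
  isSigmaCompact_ambiguity : ∀ t < T, IsSigmaCompact (D t)

/-- The real-valued indicator function of `A`. -/
noncomputable def ind {n : ℕ} (A : Set (Vec n)) : Vec n → ℝ := A.indicator (fun _ => 1)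

/-- The dynamic programming operator
`v ↦ (x ↦ sup_{u ∈ U(x)} inf_{μ ∈ D} 1_A(x) ∫ v(ξ) Q(dξ | x, u, μ))` of one stage. -/
noncomputable def dpOperator {n m l : ℕ} (f : Vec n → Vec m → Vec l → Vec n)
    (U : Vec n → Set (Vec m)) (A : Set (Vec n)) (D : Set (ProbabilityMeasure (Vec l)))
    (v : Vec n → ℝ) (x : Vec n) : ℝ :=
  ⨆ u : U x, ⨅ μ : D, ind A x * ∫ ξ, v ξ ∂(transitionLaw f x u μ)

/-- The value function `v_t = (T_t ∘ T_{t+1} ∘ ⋯ ∘ T_{T-1}) 1_A`, where `T_s` is the dynamic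
programming operator of stage `s`; the composition is empty for `t = T`. -/
noncomputable def valueFunction {n m l : ℕ} (f : Vec n → Vec m → Vec l → Vec n)
    (U : Vec n → Set (Vec m)) (D : ℕ → Set (ProbabilityMeasure (Vec l))) (T : ℕ)
    (A : Set (Vec n)) (t : ℕ) : Vec n → ℝ :=
  (List.range' t (T - t)).foldr (fun s v => dpOperator f U A (D s) v) (ind A)

end RobustSafety

/-! Backward induction shows that every value function is upper semicontinuous with values in `[0,
1]`. This makes it Borel, so the integrals make sense, and lets a compact control set yield a
maximiser. For the inductive step, fix `μ`. An upper semicontinuous `v` is a pointwise limit of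
Lipschitz majorants, its sup-convolutions, so the assumed continuity for bounded continuous
integrands gives upper semicontinuity of `∫ v dQ` in `(x, u)`
(`upperSemicontinuousOn_integral_transitionLaw`). The indicator of the closed set `A` and the
infimum over `μ` preserve this; Berge's theorem (`upperSemicontinuous_iSup_section`) handles the
supremum over controls. -/

namespace RobustSafety

open Filter Topology

/-! ### Approximation of upper semicontinuous functions from above -/

section SupConvolution

variable {X : Type*} [PseudoMetricSpace X]

/-- The sup-convolution of `v` with the cone of slope `k`. -/
noncomputable def supConvolution (v : X → ℝ) (k : ℝ) (x : X) : ℝ := ⨆ y, (v y - k * dist x y)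

lemma bddAbove_supConvolution {v : X → ℝ} (hv1 : ∀ x, v x ≤ 1) {k : ℝ} (hk : 0 ≤ k) (x : X) :
    BddAbove (range fun y => v y - k * dist x y) := by
  refine ⟨1, ?_⟩
  rintro _ ⟨y, rfl⟩
  have : 0 ≤ k * dist x y := by positivity
  have := hv1 y
  dsimp only
  linarith

lemma le_supConvolution {v : X → ℝ} (hv1 : ∀ x, v x ≤ 1) {k : ℝ} (hk : 0 ≤ k) (x : X) :
    v x ≤ supConvolution v k x := by
  have h := le_ciSup (bddAbove_supConvolution hv1 hk x) x
  rwa [dist_self, mul_zero, sub_zero] at h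

lemma supConvolution_le_one {v : X → ℝ} (hv1 : ∀ x, v x ≤ 1) {k : ℝ} (hk : 0 ≤ k) (x : X) :
    supConvolution v k x ≤ 1 := by
  have : Nonempty X := ⟨x⟩
  refine ciSup_le fun y => ?_
  have : 0 ≤ k * dist x y := by positivity
  have := hv1 y
  linarith

/-- By the triangle inequality each cone has slope `k`, and a finite supremum keeps that constant.
-/
lemma lipschitzWith_supConvolution {v : X → ℝ} (hv1 : ∀ x, v x ≤ 1) (k : NNReal) :
    LipschitzWith k (supConvolution v k) := by
  refine LipschitzWith.of_le_add_mul k fun x x' => ?_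
  have : Nonempty X := ⟨x⟩
  refine ciSup_le fun y => ?_
  have h := le_ciSup (bddAbove_supConvolution hv1 k.2 x') y
  have htri : dist x' y ≤ dist x x' + dist x y := by
    rw [dist_comm x x']
    exact dist_triangle x' x y
  have hmul := mul_le_mul_of_nonneg_left htri k.2
  change v y - (k : ℝ) * dist x' y ≤ supConvolution v k x' at h
  simp only [NNReal.val_eq_coe] at hmul
  linarith

/-- Sup-convolutions of an upper semicontinuous function converge to it pointwise. -/
lemma tendsto_supConvolution {v : X → ℝ} (hv : UpperSemicontinuous v) (hv0 : ∀ x, 0 ≤ v x)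
    (hv1 : ∀ x, v x ≤ 1) (x : X) :
    Tendsto (fun k : ℕ => supConvolution v k x) atTop (𝓝 (v x)) := by
  have : Nonempty X := ⟨x⟩
  rw [tendsto_order]
  refine ⟨fun a ha => Eventually.of_forall fun k =>
    ha.trans_le (le_supConvolution hv1 k.cast_nonneg x), fun b hb => ?_⟩
  obtain ⟨c, hvc, hcb⟩ := exists_between hb
  obtain ⟨r, hr, hball⟩ := Metric.eventually_nhds_iff.mp (hv x c hvc)
  -- From slope `1 / r` on, points at distance at least `r` pay a penalty of at least 1, so they
  -- contribute at most `0 ≤ v x`.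
  obtain ⟨N, hN⟩ := exists_nat_ge (1 / r)
  filter_upwards [eventually_ge_atTop N] with k hk
  refine lt_of_le_of_lt (ciSup_le fun y => ?_) hcb
  rcases lt_or_ge (dist y x) r with hy | hy
  · have : (0 : ℝ) ≤ k * dist x y := by positivity
    have := hball hy
    linarith
  · have h1 : 1 ≤ (k : ℝ) * r := by
      have : 1 / r ≤ (k : ℝ) := hN.trans (by exact_mod_cast hk)
      rwa [div_le_iff₀ hr] at this
    have h2 : (k : ℝ) * r ≤ k * dist x y := by
      rw [dist_comm x y]
      gcongr
    have := hv1 y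
    have := hv0 x
    linarith

lemma integrable_of_upperSemicontinuous [MeasurableSpace X] [BorelSpace X] {v : X → ℝ}
    (hv : UpperSemicontinuous v) (hv0 : ∀ x, 0 ≤ v x) (hv1 : ∀ x, v x ≤ 1) (μ : Measure X)
    [IsFiniteMeasure μ] : Integrable v μ :=
  Integrable.of_bound hv.measurable.aestronglyMeasurable 1
    (Eventually.of_forall fun x => by rw [Real.norm_of_nonneg (hv0 x)]; exact hv1 x)

/-- The integral of an upper semicontinuous function is approximated from above by integrals of
bounded continuous majorants. -/
lemma exists_boundedContinuous_ge_integral_lt [MeasurableSpace X] [BorelSpace X] {v : X → ℝ}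
    (hv : UpperSemicontinuous v) (hv0 : ∀ x, 0 ≤ v x) (hv1 : ∀ x, v x ≤ 1) (μ : Measure X)
    [IsFiniteMeasure μ] {b : ℝ} (hb : ∫ x, v x ∂μ < b) :
    ∃ g : X →ᵇ ℝ, (∀ x, v x ≤ g x) ∧ ∫ x, g x ∂μ < b := by
  have hcont : ∀ k : ℕ, Continuous (supConvolution v k) := fun k => by
    simpa using (lipschitzWith_supConvolution hv1 (k : NNReal)).continuous
  have hnorm : ∀ (k : ℕ) (x : X), ‖supConvolution v k x‖ ≤ 1 := fun k x => by
    rw [Real.norm_of_nonneg ((hv0 x).trans (le_supConvolution hv1 k.cast_nonneg x))]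
    exact supConvolution_le_one hv1 k.cast_nonneg x
  have hlim : Tendsto (fun k : ℕ => ∫ x, supConvolution v k x ∂μ) atTop (𝓝 (∫ x, v x ∂μ)) :=
    tendsto_integral_of_dominated_convergence (fun _ => 1)
      (fun k => (hcont k).measurable.aestronglyMeasurable) (integrable_const 1)
      (fun k => Eventually.of_forall (hnorm k))
      (Eventually.of_forall (tendsto_supConvolution hv hv0 hv1))
  obtain ⟨k, hk⟩ := (hlim.eventually_lt_const hb).exists
  exact ⟨BoundedContinuousFunction.ofNormedAddCommGroup _ (hcont k) 1 (hnorm k),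
    fun x => le_supConvolution hv1 k.cast_nonneg x, hk⟩

end SupConvolution

/-! ### Maximisation over compact sections -/

section Berge

lemma iSup_section_eq {X Y : Type*} {U : X → Set Y} {F : X × Y → ℝ} {x : X} {u : Y} (hu : u ∈ U x)
    (hmax : IsMaxOn (fun u => F (x, u)) (U x) u) : ⨆ u' : U x, F (x, u') = F (x, u) := by
  have : Nonempty (U x) := ⟨⟨u, hu⟩⟩
  exact le_antisymm (ciSup_le fun u' => hmax u'.2)
    (le_ciSup (f := fun u' : U x => F (x, u'))
      ⟨F (x, u), by rintro _ ⟨u', rfl⟩; exact hmax u'.2⟩ ⟨u, hu⟩)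

variable {X Y : Type*} [TopologicalSpace X] [TopologicalSpace Y]

/-- The graph of a set-valued map. -/
def graph (U : X → Set Y) : Set (X × Y) := {p | p.2 ∈ U p.1}

lemma exists_isMaxOn_section {U : X → Set Y} {F : X × Y → ℝ}
    (hF : UpperSemicontinuousOn F (graph U)) {x : X} (hc : IsCompact (U x)) (hne : (U x).Nonempty) :
    ∃ u ∈ U x, IsMaxOn (fun u => F (x, u)) (U x) u := by
  refine UpperSemicontinuousOn.exists_isMaxOn hne hc fun u hu y hy => ?_
  have htend : Tendsto (fun u' => (x, u')) (𝓝[U x] u) (𝓝[graph U] (x, u)) :=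
    tendsto_nhdsWithin_of_tendsto_nhds_of_eventually_within _
      ((Continuous.prodMk_right x).tendsto u |>.mono_left nhdsWithin_le_nhds)
      eventually_mem_nhdsWithin
  exact htend.eventually (hF (x, u) hu y hy)

/-- The upper semicontinuous half of Berge's maximum theorem. -/
lemma upperSemicontinuous_iSup_section {U : X → Set Y} {F : X × Y → ℝ}
    (hF : UpperSemicontinuousOn F (graph U)) (hU : UpperHemicontinuous U)
    (hc : ∀ x, IsCompact (U x)) (hne : ∀ x, (U x).Nonempty) :
    UpperSemicontinuous fun x => ⨆ u : U x, F (x, u) := by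
  intro x y hy
  have hlt : ∀ u ∈ U x, F (x, u) < y := fun u hu => by
    obtain ⟨u', hu', hmax⟩ := exists_isMaxOn_section hF (hc x) (hne x)
    have hy' := (iSup_section_eq hu' hmax).symm.trans_lt hy
    exact (hmax hu).trans_lt hy'
  -- Tube lemma: compactness of `U x` merges the local bounds into one on a product neighbourhood.
  -- The implication is there because `F` is controlled only on the graph.
  have hmem : {p : X × Y | p ∈ graph U → F p < y} ∈ 𝓝 x ×ˢ 𝓝ˢ (U x) := by
    refine (hc x).mem_prod_nhdsSet_of_forall fun u hu => ?_
    rw [← nhds_prod_eq]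
    exact eventually_nhdsWithin_iff.mp (hF (x, u) hu y (hlt u hu))
  obtain ⟨s, hs, t, ht, hst⟩ := mem_prod_iff.mp hmem
  filter_upwards [hs, upperHemicontinuousAt_iff.mp (hU x) t ht] with x' hx' ht'
  obtain ⟨u', hu', hmax⟩ := exists_isMaxOn_section hF (hc x') (hne x')
  rw [iSup_section_eq hu' hmax]
  exact hst ⟨hx', subset_of_mem_nhdsSet ht' hu'⟩ hu'

end Berge

/-! ### Backward induction for the value functions -/

section BellmanEquation

variable {n m l : ℕ} {f : Vec n → Vec m → Vec l → Vec n} {U : Vec n → Set (Vec m)}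
  {D : Set (ProbabilityMeasure (Vec l))} {A : Set (Vec n)} {v : Vec n → ℝ}

lemma ind_nonneg (x : Vec n) : 0 ≤ ind A x := indicator_nonneg (fun _ _ => zero_le_one) x

lemma ind_le_one (x : Vec n) : ind A x ≤ 1 :=
  indicator_le' (fun _ _ => le_rfl) (fun _ _ => zero_le_one) x

lemma upperSemicontinuous_ind (hA : IsClosed A) : UpperSemicontinuous (ind A) :=
  hA.upperSemicontinuous_indicator zero_le_one

lemma measurable_dynamics
    (hf : Measurable fun p : Vec n × Vec m × Vec l => f p.1 p.2.1 p.2.2) (x : Vec n) (u : Vec m) :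
    Measurable (f x u) :=
  hf.comp (measurable_const.prodMk (measurable_const.prodMk measurable_id))

lemma isProbabilityMeasure_transitionLaw
    (hf : Measurable fun p : Vec n × Vec m × Vec l => f p.1 p.2.1 p.2.2) (x : Vec n) (u : Vec m)
    (μ : ProbabilityMeasure (Vec l)) : IsProbabilityMeasure (transitionLaw f x u μ) :=
  Measure.isProbabilityMeasure_map (measurable_dynamics hf x u).aemeasurable

lemma integral_transitionLaw_nonneg (hv0 : ∀ x, 0 ≤ v x) (x : Vec n) (u : Vec m)
    (μ : ProbabilityMeasure (Vec l)) : 0 ≤ ∫ ξ, v ξ ∂(transitionLaw f x u μ) :=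
  integral_nonneg hv0

/-- The expected value of the next stage, as a function of state and control, for a fixed
disturbance distribution. -/
lemma upperSemicontinuousOn_integral_transitionLaw
    (hf : Measurable fun p : Vec n × Vec m × Vec l => f p.1 p.2.1 p.2.2)
    (hcont : ∀ g : Vec n →ᵇ ℝ, ContinuousOn
      (fun p : Vec n × Vec m × ProbabilityMeasure (Vec l) =>
        ∫ ξ, g ξ ∂(transitionLaw f p.1 p.2.1 p.2.2)) (admissibleTriples U D))
    (hv : UpperSemicontinuous v) (hv0 : ∀ x, 0 ≤ v x) (hv1 : ∀ x, v x ≤ 1)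
    {μ : ProbabilityMeasure (Vec l)} (hμ : μ ∈ D) :
    UpperSemicontinuousOn (fun p : Vec n × Vec m => ∫ ξ, v ξ ∂(transitionLaw f p.1 p.2 μ))
      (graph U) := by
  intro p hp y hy
  have := fun q : Vec n × Vec m => isProbabilityMeasure_transitionLaw hf q.1 q.2 μ
  -- The majorant is chosen at `p` alone; the integral of `g` stays below `y` near `p` and dominates
  -- that of `v`.
  obtain ⟨g, hvg, hg⟩ := exists_boundedContinuous_ge_integral_lt hv hv0 hv1 _ hy
  have hgc : ContinuousOn (fun q : Vec n × Vec m => ∫ ξ, g ξ ∂(transitionLaw f q.1 q.2 μ))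
      (graph U) :=
    (hcont g).comp (f := fun q : Vec n × Vec m => (q.1, q.2, μ)) (by fun_prop)
      fun q hq => ⟨hq, hμ⟩
  filter_upwards [(hgc p hp).eventually_lt_const hg] with q hq
  exact (integral_mono (integrable_of_upperSemicontinuous hv hv0 hv1 _) (g.integrable _)
    hvg).trans_lt hq

/-- The worst-case expected value of the next stage, before maximising over controls. -/
noncomputable def worstCaseValue (f : Vec n → Vec m → Vec l → Vec n) (A : Set (Vec n))
    (D : Set (ProbabilityMeasure (Vec l))) (v : Vec n → ℝ) (p : Vec n × Vec m) : ℝ :=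
  ⨅ μ : D, ind A p.1 * ∫ ξ, v ξ ∂(transitionLaw f p.1 p.2 μ)

lemma bddBelow_worstCase (hv0 : ∀ x, 0 ≤ v x) (p : Vec n × Vec m) :
    BddBelow (range fun μ : D => ind A p.1 * ∫ ξ, v ξ ∂(transitionLaw f p.1 p.2 μ)) := by
  refine ⟨0, ?_⟩
  rintro _ ⟨μ, rfl⟩
  exact mul_nonneg (ind_nonneg _) (integral_transitionLaw_nonneg hv0 _ _ _)

lemma worstCaseValue_nonneg (hv0 : ∀ x, 0 ≤ v x) (p : Vec n × Vec m) :
    0 ≤ worstCaseValue f A D v p :=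
  Real.iInf_nonneg fun _ => mul_nonneg (ind_nonneg _) (integral_transitionLaw_nonneg hv0 _ _ _)

lemma worstCaseValue_le_one
    (hf : Measurable fun p : Vec n × Vec m × Vec l => f p.1 p.2.1 p.2.2) (hD : D.Nonempty)
    (hv : UpperSemicontinuous v) (hv0 : ∀ x, 0 ≤ v x) (hv1 : ∀ x, v x ≤ 1) (p : Vec n × Vec m) :
    worstCaseValue f A D v p ≤ 1 := by
  obtain ⟨μ, hμ⟩ := hD
  have := isProbabilityMeasure_transitionLaw hf p.1 p.2 μ
  refine (ciInf_le (bddBelow_worstCase hv0 p) ⟨μ, hμ⟩).trans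
    (mul_le_one₀ (ind_le_one _) (integral_transitionLaw_nonneg hv0 _ _ _) ?_)
  calc ∫ ξ, v ξ ∂(transitionLaw f p.1 p.2 μ) ≤ ∫ _, (1 : ℝ) ∂(transitionLaw f p.1 p.2 μ) :=
        integral_mono (integrable_of_upperSemicontinuous hv hv0 hv1 _) (integrable_const 1) hv1
    _ = 1 := by simp

lemma upperSemicontinuousOn_worstCaseValue
    (hf : Measurable fun p : Vec n × Vec m × Vec l => f p.1 p.2.1 p.2.2)
    (hcont : ∀ g : Vec n →ᵇ ℝ, ContinuousOn
      (fun p : Vec n × Vec m × ProbabilityMeasure (Vec l) =>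
        ∫ ξ, g ξ ∂(transitionLaw f p.1 p.2.1 p.2.2)) (admissibleTriples U D))
    (hA : IsClosed A)
    (hv : UpperSemicontinuous v) (hv0 : ∀ x, 0 ≤ v x) (hv1 : ∀ x, v x ≤ 1) :
    UpperSemicontinuousOn (worstCaseValue f A D v) (graph U) := by
  refine upperSemicontinuousOn_ciInf (fun p _ => bddBelow_worstCase hv0 p) fun μ p hp y hy => ?_
  -- On `A` the factor is 1 at `p` and at most 1 nearby, with a nonnegative integral; off the closed
  -- set `A` it vanishes nearby.
  by_cases hpA : p.1 ∈ A
  · have hy' : ∫ ξ, v ξ ∂(transitionLaw f p.1 p.2 μ) < y := by simpa [ind, hpA] using hy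
    filter_upwards [upperSemicontinuousOn_integral_transitionLaw hf hcont hv hv0 hv1 μ.2
      p hp y hy'] with q hq
    exact (mul_le_of_le_one_left (integral_transitionLaw_nonneg hv0 _ _ _)
      (ind_le_one _)).trans_lt hq
  · have hy' : 0 < y := by simpa [ind, hpA] using hy
    have hev : ∀ᶠ q : Vec n × Vec m in 𝓝 p, q.1 ∈ Aᶜ :=
      continuous_fst.continuousAt.eventually (hA.isOpen_compl.mem_nhds hpA)
    filter_upwards [mem_nhdsWithin_of_mem_nhds hev] with q hq
    have hq' : q.1 ∉ A := hq
    simpa [ind, hq'] using hy'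

lemma dpOperator_eq_iSup_worstCaseValue (x : Vec n) :
    dpOperator f U A D v x = ⨆ u : U x, worstCaseValue f A D v (x, u) := rfl

lemma valueFunction_self (D : ℕ → Set (ProbabilityMeasure (Vec l))) (T : ℕ) :
    valueFunction f U D T A T = ind A := by
  simp [valueFunction]

lemma valueFunction_of_lt (D : ℕ → Set (ProbabilityMeasure (Vec l))) {t T : ℕ} (ht : t < T) :
    valueFunction f U D T A t = dpOperator f U A (D t) (valueFunction f U D T A (t + 1)) := by
  obtain ⟨k, rfl⟩ := Nat.exists_eq_add_of_lt ht
  have h1 : t + k + 1 - t = k + 1 := by omega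
  have h2 : t + k + 1 - (t + 1) = k := by omega
  simp [valueFunction, h1, h2, List.range'_succ]

/-- The value functions are upper semicontinuous with values in the unit interval. -/
lemma valueFunction_upperSemicontinuous {D : ℕ → Set (ProbabilityMeasure (Vec l))} {T : ℕ}
    (hf : Measurable fun p : Vec n × Vec m × Vec l => f p.1 p.2.1 p.2.2)
    (hne : ∀ x, (U x).Nonempty) (hD : ∀ t < T, (D t).Nonempty) (hA : IsClosed A)
    (hsc : SemicontinuousModel f U D T) {t : ℕ} (ht : t ≤ T) :
    UpperSemicontinuous (valueFunction f U D T A t) ∧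
      (∀ x, 0 ≤ valueFunction f U D T A t x) ∧ ∀ x, valueFunction f U D T A t x ≤ 1 := by
  induction ht using Nat.decreasingInduction with
  | self =>
    rw [valueFunction_self]
    exact ⟨upperSemicontinuous_ind hA, ind_nonneg, ind_le_one⟩
  | of_succ t ht ih =>
    obtain ⟨hv, hv0, hv1⟩ := ih
    rw [valueFunction_of_lt D ht]
    refine ⟨upperSemicontinuous_iSup_section
      (upperSemicontinuousOn_worstCaseValue hf (hsc.continuousOn_integral t ht) hA hv hv0 hv1)
      hsc.upperHemicontinuous_controls hsc.isCompact_controls hne,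
      fun x => Real.iSup_nonneg fun u => worstCaseValue_nonneg (f := f) (A := A) hv0 (x, u.1),
      fun x => ?_⟩
    have := (hne x).to_subtype
    exact ciSup_le fun u => worstCaseValue_le_one hf (hD t ht) hv hv0 hv1 (x, u.1)

end BellmanEquation

end RobustSafety

theorem mainTheorem4 (n m l T : ℕ)
    (f : RobustSafety.Vec n → RobustSafety.Vec m → RobustSafety.Vec l → RobustSafety.Vec n)
    (hf : Measurable (fun p : RobustSafety.Vec n × RobustSafety.Vec m × RobustSafety.Vec l =>
      f p.1 p.2.1 p.2.2))
    (U : RobustSafety.Vec n → Set (RobustSafety.Vec m))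
    (hU : ∃ κ : RobustSafety.Vec n → RobustSafety.Vec m, Measurable κ ∧ ∀ x, κ x ∈ U x)
    (D : ℕ → Set (ProbabilityMeasure (RobustSafety.Vec l)))
    (hD : ∀ t < T, (D t).Nonempty)
    (A : Set (RobustSafety.Vec n)) (hA : IsCompact A)
    (hsc : RobustSafety.SemicontinuousModel f U D T) :
    (∀ x, RobustSafety.valueFunction f U D T A T x = RobustSafety.ind A x) ∧
    ∀ t < T, ∀ x,
      (∀ u ∈ U x, ∀ μ ∈ D t,
        Integrable (fun w => RobustSafety.valueFunction f U D T A (t + 1) (f x u w))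
          (μ : Measure (RobustSafety.Vec l))) ∧
      IsGreatest
        {r : ℝ | ∃ u ∈ U x,
          IsGLB
            {s : ℝ | ∃ μ ∈ D t, s = RobustSafety.ind A x *
              ∫ w, RobustSafety.valueFunction f U D T A (t + 1) (f x u w)
                ∂(μ : Measure (RobustSafety.Vec l))} r}
        (RobustSafety.valueFunction f U D T A t x) := by
  have hne : ∀ x, (U x).Nonempty := fun x => hU.elim fun κ hκ => ⟨κ x, hκ.2 x⟩
  refine ⟨fun x => by rw [RobustSafety.valueFunction_self], fun t ht x => ?_⟩
  obtain ⟨hv, hv0, hv1⟩ := RobustSafety.valueFunction_upperSemicontinuous hf hne hD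
    hA.isClosed hsc (Nat.succ_le_of_lt ht)
  -- Change of variables; upper semicontinuity supplies the measurability of the integrand.
  have hint : ∀ u (μ : ProbabilityMeasure (RobustSafety.Vec l)),
      ∫ ξ, RobustSafety.valueFunction f U D T A (t + 1) ξ
        ∂(RobustSafety.transitionLaw f x u μ) =
      ∫ w, RobustSafety.valueFunction f U D T A (t + 1) (f x u w)
        ∂(μ : Measure (RobustSafety.Vec l)) := fun u μ =>
    integral_map (RobustSafety.measurable_dynamics hf x u).aemeasurable
      hv.measurable.aestronglyMeasurable
  have hglb : ∀ u, IsGLB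
      {s : ℝ | ∃ μ ∈ D t, s = RobustSafety.ind A x *
        ∫ w, RobustSafety.valueFunction f U D T A (t + 1) (f x u w)
          ∂(μ : Measure (RobustSafety.Vec l))}
      (RobustSafety.worstCaseValue f A (D t)
        (RobustSafety.valueFunction f U D T A (t + 1)) (x, u)) := fun u => by
    have := (hD t ht).to_subtype
    convert! isGLB_ciInf (RobustSafety.bddBelow_worstCase (f := f) (A := A) (D := D t)
      hv0 (x, u)) using 1
    ext s
    simp [hint, eq_comm]
  have husc := RobustSafety.upperSemicontinuousOn_worstCaseValue hf
    (hsc.continuousOn_integral t ht) hA.isClosed hv hv0 hv1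
  obtain ⟨u, hu, hmax⟩ := RobustSafety.exists_isMaxOn_section husc
    (hsc.isCompact_controls x) (hne x)
  have hval : RobustSafety.valueFunction f U D T A t x = RobustSafety.worstCaseValue f A (D t)
      (RobustSafety.valueFunction f U D T A (t + 1)) (x, u) := by
    rw [RobustSafety.valueFunction_of_lt D ht, RobustSafety.dpOperator_eq_iSup_worstCaseValue]
    exact RobustSafety.iSup_section_eq hu hmax
  refine ⟨fun u _ μ _ => ?_, ?_, ?_⟩
  · have := RobustSafety.isProbabilityMeasure_transitionLaw hf x u μ
    exact (RobustSafety.integrable_of_upperSemicontinuous hv hv0 hv1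
      (RobustSafety.transitionLaw f x u μ)).comp_measurable
      (RobustSafety.measurable_dynamics hf x u)
  · rw [hval]
    exact ⟨u, hu, hglb u⟩
  -- Uniqueness of greatest lower bounds identifies `r` with the worst-case value at `u'`.
  · rintro r ⟨u', hu', hr⟩
    rw [hval, hr.unique (hglb u')]
    exact hmax hu'
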